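/- Let $A$ be a finite alphabet. A (numerical) monadic predicate is a family $\mathbf{P}=(\mathbf{P}_n)_{n\in\mathbb{N}}$ with $\mathbf{P}_n\subseteq\{0,\dots,n-1\}$ for every $n$; $\mathrm{Arb}_1$ is the class of all of them. Such a predicate is *regular* if it is a Boolean combination (taken at each length $n$) of local predicates, namely $\{c\}$ and $\mathbf{last}-c=(\{n-1-c\}\cap\{0,\dots,n-1\})_{n}$ with $c\in\mathbb{N}$, and modular predicates, namely $\{x\mid x\equiv r \bmod q\}$ and $\mathbf{last}\equiv r\bmod q$ (all positions if $n-1\equiv r\bmod q$, none otherwise) with $q,r\in\mathbb{N}$. Monadic second-order (MSO) formulae over $A$ with predicate symbols $P_1,\dots,P_\ell$ are built from the atoms $\mathbf{a}(x)$ for $a\in A$ ("position $x$ carries the letter $a$"), $x\le y$, $P_i(x)$ and $x\in X$, by Boolean connectives and by quantification over positions $x$ and over sets of positions $X$. For a sentence $\varphi(P_1,\dots,P_\ell)$ and predicates $\overline{\mathbf{P}}=(\mathbf{P}^1,\dots,\mathbf{P}^\ell)$, let $L_{\varphi,\overline{\mathbf{P}}}\subseteq A^*$ be the language of all finite words $u$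 that satisfy $\varphi$ when, $n$ being the length of $u$, each $P_i$ is interpreted by $\mathbf{P}^i_n$. **Theorem.** For every MSO sentence $\varphi(P_1,\dots,P_\ell)$ and all monadic predicates $\overline{\mathbf{P}}\in\mathrm{Arb}_1^{\ell}$ such that $L_{\varphi,\overline{\mathbf{P}}}$ is a regular language, there exist regular monadic predicates $\overline{\mathbf{Q}}=(\mathbf{Q}^1,\dots,\mathbf{Q}^\ell)$ such that $L_{\varphi,\overline{\mathbf{Q}}}=L_{\varphi,\overline{\mathbf{P}}}$. -/

import Mathlib

/-- A numerical monadic predicate: for each length `n`, a set of positions in `{0, …, n - 1}`.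
No uniformity or computability is required. -/
abbrev MonadicPredicate : Type := (n : ℕ) → Set (Fin n)

namespace MonadicPredicate

/-- The local predicate `{c}`. -/
def isPos (c : ℕ) : MonadicPredicate := fun _ => {x | (x : ℕ) = c}

/-- The local predicate `last - c`, whose only element at length `n` is the position `n - 1 - c`
if there is such a position. -/
def isLastSub (c : ℕ) : MonadicPredicate := fun n => {x | (x : ℕ) + c + 1 = n}

/-- The modular predicate `x ≡ r mod q`. -/
def posMod (r q : ℕ) : MonadicPredicate := fun _ => {x | (x : ℕ) ≡ r [MOD q]}

/-- The modular predicate `last ≡ r mod q`: all positions if the last position `n - 1` is congruent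
to `r` modulo `q`, and none otherwise. (There is a position `x` only if `n ≥ 1`.) -/
def lastMod (r q : ℕ) : MonadicPredicate := fun n => {_x | n - 1 ≡ r [MOD q]}

/-- The local predicates. -/
def localPredicates : Set MonadicPredicate := Set.range isPos ∪ Set.range isLastSub

/-- The modular predicates. -/
def modularPredicates : Set MonadicPredicate :=
  {P | ∃ r q : ℕ, P = posMod r q} ∪ {P | ∃ r q : ℕ, P = lastMod r q}

/-- A monadic predicate is regular if it is a Boolean combination of local and modular predicates
(the Boolean operations being taken at each length). -/
def IsRegular (P : MonadicPredicate) : Prop :=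
  P ∈ BooleanSubalgebra.closure (localPredicates ∪ modularPredicates)

end MonadicPredicate

/-- Monadic second-order formulae over words on the alphabet `A`, with predicate symbols
`P_0, …, P_{ℓ-1}`, whose free first-order variables are among `x_0, …, x_{p-1}` and whose free
second-order variables are among `X_0, …, X_{q-1}`. A quantifier binds the variable of index `0`
and shifts the others by one. -/
inductive MSOFormula (A : Type*) (ℓ : ℕ) : ℕ → ℕ → Type _
  /-- The letter at position `x` is `a`. -/
  | letter {p q : ℕ} (a : A) (x : Fin p) : MSOFormula A ℓ p q
  /-- `x ≤ y` -/
  | le {p q : ℕ} (x y : Fin p) : MSOFormula A ℓ p q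
  /-- `P_i(x)` for a numerical predicate symbol -/
  | pred {p q : ℕ} (i : Fin ℓ) (x : Fin p) : MSOFormula A ℓ p q
  /-- `X(x)` for a second-order variable -/
  | mem {p q : ℕ} (X : Fin q) (x : Fin p) : MSOFormula A ℓ p q
  /-- conjunction -/
  | and {p q : ℕ} (φ ψ : MSOFormula A ℓ p q) : MSOFormula A ℓ p q
  /-- negation -/
  | not {p q : ℕ} (φ : MSOFormula A ℓ p q) : MSOFormula A ℓ p q
  /-- `∃ x, φ` -/
  | existsFO {p q : ℕ} (φ : MSOFormula A ℓ (p + 1) q) : MSOFormula A ℓ p q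
  /-- `∃ X, φ` -/
  | existsSO {p q : ℕ} (φ : MSOFormula A ℓ p (q + 1)) : MSOFormula A ℓ p q

/-- A sentence is a formula without free variables. -/
abbrev MSOSentence (A : Type*) (ℓ : ℕ) := MSOFormula A ℓ 0 0

namespace MSOFormula

/-- The satisfaction relation `u, P, x, X ⊨ φ`, for a word `u` of length `n`. -/
def Sat {A : Type*} {ℓ n : ℕ} (u : Fin n → A) (P : Fin ℓ → MonadicPredicate) :
    {p q : ℕ} → MSOFormula A ℓ p q → (Fin p → Fin n) → (Fin q → Set (Fin n)) → Prop
  | _, _, letter a y, x, _ => u (x y) = a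
  | _, _, le y z, x, _ => x y ≤ x z
  | _, _, pred i y, x, _ => x y ∈ P i n
  | _, _, mem Y y, x, X => x y ∈ X Y
  | _, _, and φ ψ, x, X => Sat u P φ x X ∧ Sat u P ψ x X
  | _, _, not φ, x, X => ¬ Sat u P φ x X
  | _, _, existsFO φ, x, X => ∃ y : Fin n, Sat u P φ (Fin.cons y x) X
  | _, _, existsSO φ, x, X => ∃ Y : Set (Fin n), Sat u P φ x (Fin.cons Y X)

end MSOFormula

/-- The language `L_{φ,P}` of all finite words satisfying the sentence `φ` when its predicate
symbols are interpreted by the predicates `P`. -/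
def MSOSentence.language {A : Type*} {ℓ : ℕ} (φ : MSOSentence A ℓ)
    (P : Fin ℓ → MonadicPredicate) : Language A :=
  {w : List A | MSOFormula.Sat w.get P φ Fin.elim0 Fin.elim0}

/-! Code the values of the predicates at length n as one word of length n over the alphabet of
subsets of `Fin ℓ`, and call it good if it makes φ define the length-n words of L. By the usual
translation of MSO into automata, the good words form a regular language: it is the complement of
the projection of the words on which φ and L disagree (`MSOSentence.isRegular_advice`). The given
predicates, however wild, provide a good word of every length.

It remains to choose good words uniformly (`IsRegular.exists_regular_choice`). For each residue r
modulo q = N!, with N the number of states, pump a single good word into x y^k z. Since |y| divides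
q, this reaches every large length n with n - 1 ≡ r. A letter of x y^k z depends only on truncated
distances to both ends and on residues, so the chosen predicates are regular. -/

namespace Language

/-! ### Closure properties and basic regular languages -/

variable {α β : Type*}

/-- The image of a regular language under a letter-to-letter morphism is regular. -/
theorem IsRegular.map {L : Language α} (hL : L.IsRegular) (f : α → β) :
    (Language.map f L).IsRegular := by
  obtain ⟨σ, _, M, rfl⟩ := hL
  let N : NFA β σ := ⟨fun s b => {t | ∃ a, f a = b ∧ M.step s a = t}, {M.start}, M.accept⟩
  have key : ∀ (w : List β) (s t : σ),
      t ∈ N.evalFrom {s} w ↔ ∃ v : List α, v.map f = w ∧ M.evalFrom s v = t := by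
    intro w
    induction w with
    | nil => simp [DFA.evalFrom, eq_comm]
    | cons b w ih =>
      intro s t
      rw [NFA.evalFrom_cons, NFA.stepSet_singleton, NFA.mem_evalFrom_iff_exists]
      constructor
      · rintro ⟨_, ⟨a, rfl, rfl⟩, h⟩
        obtain ⟨v, rfl, rfl⟩ := (ih _ _).1 h
        exact ⟨a :: v, rfl, rfl⟩
      · rintro ⟨v, hv, rfl⟩
        obtain ⟨a, v, rfl, rfl, rfl⟩ := List.map_eq_cons_iff.1 hv
        exact ⟨_, ⟨a, rfl, rfl⟩, (ih _ _).2 ⟨v, rfl, rfl⟩⟩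
  classical
  refine ⟨Set σ, inferInstance, N.toDFA, ?_⟩
  rw [NFA.toDFA_correct]
  ext w
  rw [NFA.mem_accepts]
  constructor
  · rintro ⟨t, ht, h⟩
    obtain ⟨v, rfl, rfl⟩ := (key _ _ _).1 h
    exact ⟨v, ht, rfl⟩
  · rintro ⟨v, hv, rfl⟩
    exact ⟨_, hv, (key _ _ _).2 ⟨v, rfl, rfl⟩⟩

/-- The inverse image of a language under a letter-to-letter morphism. -/
def comap (f : α → β) (L : Language β) : Language α := {w | w.map f ∈ L}

/-- The inverse image of a regular language under a letter-to-letter morphism is regular. -/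
theorem IsRegular.comap {L : Language β} (hL : L.IsRegular) (f : α → β) :
    (Language.comap f L).IsRegular := by
  obtain ⟨σ, _, M, rfl⟩ := hL
  exact ⟨σ, inferInstance, M.comap f, DFA.accepts_comap M f⟩

/-- The words with a letter in `S`. -/
def containsLetter (S : Set α) : Language α := {w | ∃ a ∈ w, a ∈ S}

/-- The words with a letter in `S` and, strictly to its right, a letter in `T`. -/
def containsPair (S T : Set α) : Language α :=
  {w | ¬ w.Pairwise fun a b => ¬ (a ∈ S ∧ b ∈ T)}

theorem isRegular_containsLetter (S : Set α) : (containsLetter S).IsRegular := by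
  classical
  let M : DFA α Prop := ⟨fun s a => s ∨ a ∈ S, False, {s | s}⟩
  have key : ∀ (w : List α) (s : Prop), M.evalFrom s w ↔ s ∨ ∃ a ∈ w, a ∈ S := by
    intro w
    induction w with
    | nil => simp [DFA.evalFrom]
    | cons a w ih =>
      intro s
      rw [DFA.evalFrom_cons, ih]
      simp [M, or_assoc]
  refine ⟨Prop, inferInstance, M, ?_⟩
  ext w
  exact (key w False).trans (by simp [containsLetter]; rfl)

theorem isRegular_containsPair (S T : Set α) : (containsPair S T).IsRegular := by
  classical
  -- The state records whether a letter of `S` has been read, and whether a pair has been completed.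
  let M : DFA α (Prop × Prop) :=
    ⟨fun s a => (s.1 ∨ a ∈ S, s.2 ∨ (s.1 ∧ a ∈ T)), (False, False), {s | s.2}⟩
  have key : ∀ (w : List α) (s : Prop × Prop), (M.evalFrom s w).2 ↔
      s.2 ∨ (s.1 ∧ ∃ b ∈ w, b ∈ T) ∨ ¬ w.Pairwise fun a b => ¬ (a ∈ S ∧ b ∈ T) := by
    intro w
    induction w with
    | nil => simp [DFA.evalFrom]
    | cons a w ih =>
      intro s
      rw [DFA.evalFrom_cons, ih, List.pairwise_cons]
      simp only [M, List.mem_cons, exists_eq_or_imp]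
      have : (¬ ∀ b ∈ w, ¬ (a ∈ S ∧ b ∈ T)) ↔ a ∈ S ∧ ∃ b ∈ w, b ∈ T := by
        push Not
        aesop
      rw [not_and_or, this]
      clear this ih
      grind
  refine ⟨Prop × Prop, inferInstance, M, ?_⟩
  ext w
  exact (key w (False, False)).trans (by simp [containsPair]; rfl)

theorem ofFn_mem_map_iff {L : Language α} {f : α → β} {n : ℕ} {g : Fin n → β} :
    List.ofFn g ∈ map f L ↔
    ∃ h : Fin n → α, (∀ i, f (h i) = g i) ∧ List.ofFn h ∈ L := by
  constructor
  · rintro ⟨v, hv, hvg⟩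
    have hn : v.length = n := by simpa using congrArg List.length hvg
    subst hn
    refine ⟨v.get, fun i => ?_, by rwa [List.ofFn_get]⟩
    have := congrArg (fun l => l[(i : ℕ)]?) hvg
    simpa using this
  · rintro ⟨h, hg, hL⟩
    refine ⟨_, hL, ?_⟩
    rw [List.map_ofFn]
    exact congrArg List.ofFn (funext hg)

theorem ofFn_mem_comap {n : ℕ} {g : Fin n → α} {f : α → β} {L : Language β} :
    List.ofFn g ∈ comap f L ↔ List.ofFn (fun i => f (g i)) ∈ L := by
  change (List.ofFn g).map f ∈ L ↔ _
  rw [List.map_ofFn]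
  rfl

theorem ofFn_mem_containsLetter {n : ℕ} {f : Fin n → α} {S : Set α} :
    List.ofFn f ∈ containsLetter S ↔ ∃ i, f i ∈ S := by
  simp only [containsLetter]
  change (∃ a ∈ List.ofFn f, a ∈ S) ↔ _
  simp [List.mem_ofFn]

theorem ofFn_mem_containsPair {n : ℕ} {f : Fin n → α} {S T : Set α} :
    List.ofFn f ∈ containsPair S T ↔ ∃ i j, i < j ∧ f i ∈ S ∧ f j ∈ T := by
  change (¬ List.Pairwise _ (List.ofFn f)) ↔ _
  rw [List.pairwise_ofFn]
  push Not
  simp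

end Language

/-! ### From MSO formulae to regular languages -/

namespace MSOFormula

open Language

variable {A : Type*} {ℓ : ℕ}

/-- The alphabet of words with tracks for the numerical predicates and the free variables. -/
abbrev TrackAlphabet (A : Type*) (ℓ p q : ℕ) : Type _ :=
  A × Set (Fin ℓ) × Set (Fin p) × Set (Fin q)

/-- Forget the track of the first-order variable of index `0`. -/
def dropFO {p q : ℕ} (s : TrackAlphabet A ℓ (p + 1) q) : TrackAlphabet A ℓ p q :=
  (s.1, s.2.1, Fin.succ ⁻¹' s.2.2.1, s.2.2.2)

/-- Forget the track of the second-order variable of index `0`. -/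
def dropSO {p q : ℕ} (s : TrackAlphabet A ℓ p (q + 1)) : TrackAlphabet A ℓ p q :=
  (s.1, s.2.1, s.2.2.1, Fin.succ ⁻¹' s.2.2.2)

/-- The words over the alphabet with tracks that satisfy a formula. A first-order variable stands
for any set of positions in the atoms, and for a singleton where it is quantified. -/
def trackLanguage : {p q : ℕ} → MSOFormula A ℓ p q → Language (TrackAlphabet A ℓ p q)
  | _, _, letter a y => containsLetter {s | y ∈ s.2.2.1 ∧ s.1 = a}
  | _, _, le y z => containsPair {s | y ∈ s.2.2.1} {s | z ∈ s.2.2.1} +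
      containsLetter {s | y ∈ s.2.2.1 ∧ z ∈ s.2.2.1}
  | _, _, pred i y => containsLetter {s | y ∈ s.2.2.1 ∧ i ∈ s.2.1}
  | _, _, mem Y y => containsLetter {s | y ∈ s.2.2.1 ∧ Y ∈ s.2.2.2}
  | _, _, and φ ψ => trackLanguage φ ⊓ trackLanguage ψ
  | _, _, not φ => (trackLanguage φ)ᶜ
  | _, _, existsFO φ => Language.map dropFO
      (trackLanguage φ ⊓ (containsLetter {s | 0 ∈ s.2.2.1} ⊓
        (containsPair {s | 0 ∈ s.2.2.1} {s | 0 ∈ s.2.2.1})ᶜ))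
  | _, _, existsSO φ => Language.map dropSO (trackLanguage φ)

theorem isRegular_trackLanguage {p q : ℕ} (φ : MSOFormula A ℓ p q) :
    (trackLanguage φ).IsRegular := by
  induction φ with
  | letter a y => exact isRegular_containsLetter _
  | le y z => exact (isRegular_containsPair _ _).add (isRegular_containsLetter _)
  | pred i y => exact isRegular_containsLetter _
  | mem Y y => exact isRegular_containsLetter _
  | and φ ψ hφ hψ => exact hφ.inf hψ
  | not φ hφ => exact hφ.compl
  | existsFO φ hφ =>
    exact (hφ.inf ((isRegular_containsLetter _).inf (isRegular_containsPair _ _).compl)).map _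
  | existsSO φ hφ => exact hφ.map _

/-- The letter with tracks at position `i` of a word with an assignment. -/
def trackLetter {n p q : ℕ} (u : Fin n → A) (m : Fin n → Set (Fin ℓ)) (x : Fin p → Fin n)
    (X : Fin q → Set (Fin n)) (i : Fin n) : TrackAlphabet A ℓ p q :=
  (u i, m i, {j | x j = i}, {k | i ∈ X k})

/-- Negation is a plain complement, so `trackLanguage` may contain words whose first-order tracks
are not singletons. This is harmless, since only words coming from genuine assignments are tested
here. -/
theorem ofFn_trackLetter_mem_trackLanguage {n p q : ℕ} (u : Fin n → A)
    (P : Fin ℓ → MonadicPredicate) (φ : MSOFormula A ℓ p q) (x : Fin p → Fin n)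
    (X : Fin q → Set (Fin n)) :
    List.ofFn (trackLetter u (fun i => {k | i ∈ P k n}) x X) ∈ trackLanguage φ ↔
      Sat u P φ x X := by
  induction φ with
  | letter a y => simp [trackLanguage, Sat, ofFn_mem_containsLetter, trackLetter]
  | le y z =>
    simp only [trackLanguage, Sat]
    rw [Language.mem_add, ofFn_mem_containsLetter, ofFn_mem_containsPair]
    simp [trackLetter, le_iff_lt_or_eq, eq_comm]
  | pred i y => simp [trackLanguage, Sat, ofFn_mem_containsLetter, trackLetter]
  | mem Y y => simp [trackLanguage, Sat, ofFn_mem_containsLetter, trackLetter]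
  | and φ ψ hφ hψ =>
    simp only [trackLanguage, Sat]
    exact and_congr (hφ x X) (hψ x X)
  | not φ hφ =>
    simp only [trackLanguage, Sat]
    exact not_congr (hφ x X)
  | existsFO φ hφ =>
    simp only [trackLanguage, Sat]
    rw [ofFn_mem_map_iff]
    constructor
    · rintro ⟨h, hh, h1, h2, h3⟩
      obtain ⟨y, hy⟩ := ofFn_mem_containsLetter.1 h2
      -- Excluding pairs of marked positions makes the new track a singleton, hence the track of a
      -- position.
      have huniq : ∀ i, 0 ∈ (h i).2.2.1 → i = y := by
        intro i hi
        by_contra hne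
        refine h3 (ofFn_mem_containsPair.2 ?_)
        rcases lt_or_gt_of_ne hne with hlt | hlt
        · exact ⟨i, y, hlt, hi, hy⟩
        · exact ⟨y, i, hlt, hy, hi⟩
      refine ⟨y, (hφ _ _).1 (Eq.subst (motive := fun g => List.ofFn g ∈ trackLanguage φ)
        (funext fun i => Eq.symm ?_) h1)⟩
      have := hh i
      simp only [dropFO, trackLetter, Prod.mk.injEq] at this
      obtain ⟨e1, e2, e3, e4⟩ := this
      refine Prod.ext e1.symm (Prod.ext e2.symm (Prod.ext ?_ e4.symm))
      ext j
      refine Fin.cases ?_ (fun j => ?_) j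
      · exact ⟨fun e => by rw [← show y = i from e]; exact hy, fun e => (huniq i e).symm⟩
      · exact (Set.ext_iff.1 e3 j).symm
    · rintro ⟨y, hy⟩
      refine ⟨_, fun i => ?_, (hφ _ _).2 hy, ofFn_mem_containsLetter.2 ⟨y, ?_⟩, fun h => ?_⟩
      · rfl
      · simp [trackLetter]
      · obtain ⟨i, j, hij, hi, hj⟩ := ofFn_mem_containsPair.1 h
        exact hij.ne (Eq.trans (Eq.symm hi) hj)
  | existsSO φ hφ =>
    simp only [trackLanguage, Sat]
    rw [ofFn_mem_map_iff]
    constructor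
    · rintro ⟨h, hh, h1⟩
      refine ⟨{i | 0 ∈ (h i).2.2.2}, (hφ _ _).1 (Eq.subst (motive := fun g => List.ofFn g ∈ trackLanguage φ)
        (funext fun i => Eq.symm ?_) h1)⟩
      have := hh i
      simp only [dropSO, trackLetter, Prod.mk.injEq] at this
      obtain ⟨e1, e2, e3, e4⟩ := this
      refine Prod.ext e1.symm (Prod.ext e2.symm (Prod.ext e3.symm ?_))
      ext j
      refine Fin.cases Iff.rfl (fun j => ?_) j
      exact (Set.ext_iff.1 e4 j).symm
    · rintro ⟨Y, hY⟩
      exact ⟨_, fun i => rfl, (hφ _ _).2 hY⟩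

end MSOFormula

/-! ### The regular language of good interpretations -/

/-- The words over `Set (Fin ℓ)` that, as interpretations of the numerical predicates, make the
sentence `φ` define `L` at their length. -/
def MSOSentence.advice {A : Type*} {ℓ : ℕ} (φ : MSOSentence A ℓ) (L : Language A) :
    Language (Set (Fin ℓ)) :=
  (Language.map (fun s : MSOFormula.TrackAlphabet A ℓ 0 0 => s.2.1)
    (MSOFormula.trackLanguage φ ⊓ (Language.comap Prod.fst L)ᶜ +
      (MSOFormula.trackLanguage φ)ᶜ ⊓ Language.comap Prod.fst L))ᶜ

theorem MSOSentence.isRegular_advice {A : Type*} {ℓ : ℕ} (φ : MSOSentence A ℓ) {L : Language A}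
    (hL : L.IsRegular) : (φ.advice L).IsRegular :=
  (((φ.isRegular_trackLanguage.inf (hL.comap _).compl).add
    (φ.isRegular_trackLanguage.compl.inf (hL.comap _))).map _).compl

theorem MSOSentence.ofFn_mem_advice {A : Type*} {ℓ : ℕ} (φ : MSOSentence A ℓ) (L : Language A)
    (P : Fin ℓ → MonadicPredicate) (n : ℕ) :
    List.ofFn (fun i : Fin n => {k | i ∈ P k n}) ∈ φ.advice L ↔
      ∀ u : Fin n → A, List.ofFn u ∈ L ↔ MSOFormula.Sat u P φ Fin.elim0 Fin.elim0 := by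
  refine (not_congr Language.ofFn_mem_map_iff).trans ?_
  rw [not_exists]
  constructor
  · intro h u
    have := h (MSOFormula.trackLetter u (fun i : Fin n => {k | i ∈ P k n}) Fin.elim0 Fin.elim0)
    rw [Language.mem_add] at this
    have h1 := MSOFormula.ofFn_trackLetter_mem_trackLanguage u P φ Fin.elim0 Fin.elim0
    have h2 : List.ofFn (MSOFormula.trackLetter u (fun i : Fin n => {k | i ∈ P k n})
        Fin.elim0 Fin.elim0) ∈ Language.comap Prod.fst L ↔ List.ofFn u ∈ L :=
      Language.ofFn_mem_comap
    rw [← h1, ← h2]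
    by_contra hne
    refine this ⟨fun i => rfl, ?_⟩
    by_cases hc : List.ofFn (MSOFormula.trackLetter u (fun i : Fin n => {k | i ∈ P k n})
        Fin.elim0 Fin.elim0) ∈ MSOFormula.trackLanguage φ
    · exact Or.inl ⟨hc, fun h => hne ⟨fun _ => hc, fun _ => h⟩⟩
    · refine Or.inr ⟨hc, ?_⟩
      by_contra h
      exact hne ⟨fun h' => absurd h' h, fun h' => absurd h' hc⟩
  · rintro h s ⟨hs, hmem⟩
    -- A sentence has no variable tracks, so a track word is just a word over `A` paired with an
    -- interpretation.
    have e : s = MSOFormula.trackLetter (fun i => (s i).1) (fun i : Fin n => {k | i ∈ P k n})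
        Fin.elim0 Fin.elim0 := by
      funext i
      exact Prod.ext rfl (Prod.ext (hs i) (Prod.ext (Subsingleton.elim _ _)
        (Subsingleton.elim _ _)))
    have h1 := MSOFormula.ofFn_trackLetter_mem_trackLanguage (fun i => (s i).1) P φ Fin.elim0
      Fin.elim0
    rw [← e, ← h] at h1
    have h2 : List.ofFn s ∈ Language.comap Prod.fst L ↔
        List.ofFn (fun i => (s i).1) ∈ L :=
      Language.ofFn_mem_comap
    rcases hmem with ⟨ha, hb⟩ | ⟨ha, hb⟩
    · exact hb (h2.2 (h1.1 ha))
    · exact ha (h1.2 (h2.1 hb))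

/-! ### Regular predicates and colorings -/

namespace MonadicPredicate

theorem IsRegular.sup {P Q : MonadicPredicate} (hP : P.IsRegular) (hQ : Q.IsRegular) :
    IsRegular (P ⊔ Q) := BooleanSubalgebra.sup_mem hP hQ

theorem IsRegular.inf {P Q : MonadicPredicate} (hP : P.IsRegular) (hQ : Q.IsRegular) :
    IsRegular (P ⊓ Q) := BooleanSubalgebra.inf_mem hP hQ

theorem IsRegular.compl {P : MonadicPredicate} (hP : P.IsRegular) : IsRegular Pᶜ :=
  BooleanSubalgebra.compl_mem hP

theorem isRegular_bot : IsRegular ⊥ := BooleanSubalgebra.bot_mem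

theorem isRegular_isPos (c : ℕ) : IsRegular (isPos c) :=
  BooleanSubalgebra.mem_closure_of_mem (Or.inl (Or.inl ⟨c, rfl⟩))

theorem isRegular_isLastSub (c : ℕ) : IsRegular (isLastSub c) :=
  BooleanSubalgebra.mem_closure_of_mem (Or.inl (Or.inr ⟨c, rfl⟩))

theorem isRegular_posMod (r q : ℕ) : IsRegular (posMod r q) :=
  BooleanSubalgebra.mem_closure_of_mem (Or.inr (Or.inl ⟨r, q, rfl⟩))

theorem isRegular_lastMod (r q : ℕ) : IsRegular (lastMod r q) :=
  BooleanSubalgebra.mem_closure_of_mem (Or.inr (Or.inr ⟨r, q, rfl⟩))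

/-- A regular coloring of the positions of all lengths: one whose color classes are regular. -/
def IsRegularColoring {κ : Type*} (c : (n : ℕ) → Fin n → κ) : Prop :=
  ∀ k, IsRegular fun n => {i | c n i = k}

theorem isRegular_biUnion {ι : Type*} (s : Finset ι) (P : ι → MonadicPredicate)
    (h : ∀ a ∈ s, (P a).IsRegular) : IsRegular fun n => {i | ∃ a ∈ s, i ∈ P a n} := by
  classical
  induction s using Finset.induction_on with
  | empty =>
    convert isRegular_bot
    simp
  | insert a s _ ih =>
    convert (h a (by simp)).sup (ih fun b hb => h b (by simp [hb])) using 1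
    funext n
    ext i
    simp

/-- A predicate that only depends on a regular coloring with finitely many colors is regular. -/
theorem IsRegularColoring.isRegular {κ : Type*} {c : (n : ℕ) → Fin n → κ}
    (hc : IsRegularColoring c) (s : Finset κ) (hs : ∀ n i, c n i ∈ s) {P : MonadicPredicate}
    (hP : ∀ n n' i i', c n i = c n' i' → i ∈ P n → i' ∈ P n') : P.IsRegular := by
  classical
  convert isRegular_biUnion (s.filter fun k => ∃ n i, c n i = k ∧ i ∈ P n)
    (fun k n => {i | c n i = k}) (fun k _ => hc k) using 1
  funext n
  ext i
  constructor
  · intro hi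
    exact ⟨c n i, Finset.mem_filter.2 ⟨hs n i, n, i, rfl, hi⟩, rfl⟩
  · rintro ⟨k, hk, rfl⟩
    obtain ⟨-, n', i', h, hi'⟩ := Finset.mem_filter.1 hk
    exact hP _ _ _ _ h hi'

theorem IsRegularColoring.prod {κ ι : Type*} {c : (n : ℕ) → Fin n → κ} {d : (n : ℕ) → Fin n → ι}
    (hc : IsRegularColoring c) (hd : IsRegularColoring d) :
    IsRegularColoring fun n i => (c n i, d n i) := by
  intro k
  convert (hc k.1).inf (hd k.2) using 1
  funext n
  ext i
  simp [Prod.ext_iff]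

theorem isRegularColoring_min {c : (n : ℕ) → Fin n → ℕ} (hc : IsRegularColoring c) (C : ℕ) :
    IsRegularColoring fun n i => min (c n i) C := by
  intro k
  rcases lt_trichotomy k C with h | rfl | h
  · convert hc k using 3
    ext i
    simp only
    omega
  -- The threshold color gathers infinitely many colors, but its complement is a finite union.
  · convert (isRegular_biUnion (Finset.range k) (fun a n => {i | c n i = a})
      (fun a _ => hc a)).compl using 1
    funext n
    ext i
    simp
  · convert isRegular_bot
    ext i
    simp
    omega

theorem isRegularColoring_pos : IsRegularColoring fun _ i => (i : ℕ) := isRegular_isPos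

theorem isRegularColoring_lastSub : IsRegularColoring fun n i => n - 1 - (i : ℕ) := by
  intro k
  convert isRegular_isLastSub k using 1
  funext n
  ext i
  simp only [isLastSub, Set.mem_ofPred_eq]
  omega

theorem isRegularColoring_posMod (q : ℕ) : IsRegularColoring fun _ i => (i : ℕ) % q := by
  intro k
  by_cases h : k % q = k
  · convert isRegular_posMod k q using 1
    funext n
    ext i
    simp [posMod, Nat.ModEq, h]
  · convert isRegular_bot
    ext i
    simp
    rintro rfl
    simp at h

theorem isRegularColoring_lastMod (q : ℕ) : IsRegularColoring fun n _ => (n - 1) % q := by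
  intro k
  by_cases h : k % q = k
  · convert isRegular_lastMod k q using 1
    funext n
    ext i
    simp [lastMod, Nat.ModEq, h]
  · convert isRegular_bot
    ext i
    simp
    rintro rfl
    simp at h

/-- A predicate is regular if it only depends on the distances of a position to both ends, up to
a threshold, and on the residues of the position and of the last position. -/
theorem isRegular_of_threshold_mod (C : ℕ) {q : ℕ} (hq : 0 < q) {P : MonadicPredicate}
    (hP : ∀ (n n' : ℕ) (i : Fin n) (i' : Fin n'), min (i : ℕ) C = min (i' : ℕ) C →
      min (n - 1 - i) C = min (n' - 1 - i') C → (i : ℕ) % q = i' % q →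
      (n - 1) % q = (n' - 1) % q → i ∈ P n → i' ∈ P n') : P.IsRegular := by
  refine ((isRegularColoring_min isRegularColoring_pos C).prod
    ((isRegularColoring_min isRegularColoring_lastSub C).prod
      ((isRegularColoring_posMod q).prod (isRegularColoring_lastMod q)))).isRegular
    (Finset.range (C + 1) ×ˢ Finset.range (C + 1) ×ˢ Finset.range q ×ˢ Finset.range q) ?_ ?_
  · intro n i
    simp [Nat.mod_lt _ hq]
  · intro n n' i i' h
    simp only [Prod.mk.injEq] at h
    exact hP n n' i i' h.1 h.2.1 h.2.2.1 h.2.2.2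

end MonadicPredicate

/-! ### Regular choice by pumping -/

namespace Language

variable {β : Type*}

/-- The letter at position `i` of the word of length `n` in `x y* z`, if there is one. -/
def pumpLetter [Inhabited β] (x y z : List β) (n i : ℕ) : β :=
  if i < x.length then x.getD i default
  else if n - 1 - i < z.length then z.reverse.getD (n - 1 - i) default
  else y.getD ((i - x.length) % y.length) default

/-- The suffix `z` is indexed from the right end and `y` modulo its length, so the formula for a
letter does not mention `k`. -/
theorem ofFn_pumpLetter [Inhabited β] (x y z : List β) (k : ℕ) :
    List.ofFn (fun i : Fin (x.length + k * y.length + z.length) =>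
      pumpLetter x y z (x.length + k * y.length + z.length) i) =
    x ++ (List.replicate k y).flatten ++ z := by
  have hrep : ∀ (k j : ℕ), j < k * y.length →
      (List.replicate k y).flatten[j]? = y[j % y.length]? := by
    intro k
    induction k with
    | zero => simp
    | succ k ih =>
      intro j hj
      rw [List.replicate_succ, List.flatten_cons]
      rcases lt_or_ge j y.length with h | h
      · rw [List.getElem?_append_left h, Nat.mod_eq_of_lt h]
      · rw [List.getElem?_append_right h, ih _ (by rw [Nat.succ_mul] at hj; omega),
          ← Nat.mod_eq_sub_mod h]
  have hlen : (List.replicate k y).flatten.length = k * y.length := by simp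
  refine List.ext_getElem? fun j => ?_
  rcases lt_or_ge j (x.length + k * y.length + z.length) with hj | hj
  · rw [List.getElem?_ofFn, dif_pos hj]
    simp only [pumpLetter]
    split_ifs with h1 h2
    · rw [List.append_assoc, List.getElem?_append_left h1]
      simp [h1]
    · rw [List.getElem?_append_right (by rw [List.length_append, hlen]; omega),
        List.length_append, hlen, List.getD_eq_getElem?_getD, List.getElem?_reverse h2]
      rw [show z.length - 1 - (x.length + k * y.length + z.length - 1 - j) =
        j - (x.length + k * y.length) by omega]
      rw [List.getElem?_eq_getElem (by omega)]
      rfl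
    · have hy : 0 < y.length := by
        rcases Nat.eq_zero_or_pos y.length with h | h
        · rw [h] at hj h2
          omega
        · exact h
      rw [List.append_assoc, List.getElem?_append_right (by omega),
        List.getElem?_append_left (by rw [hlen]; omega), hrep _ _ (by omega),
        List.getElem?_eq_getElem (Nat.mod_lt _ hy)]
      simp [Nat.mod_lt _ hy]
  · rw [List.getElem?_eq_none (by simpa using hj),
      List.getElem?_eq_none (by simp only [List.length_append, hlen]; omega)]

/-- A regular language with a word of each length has a regular choice of such words. -/
theorem IsRegular.exists_regular_choice {L : Language β} (hL : L.IsRegular)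
    (w : (n : ℕ) → Fin n → β) (hw : ∀ n, List.ofFn (w n) ∈ L) :
    ∃ f : (n : ℕ) → Fin n → β, (∀ n, List.ofFn (f n) ∈ L) ∧
      ∀ S : Set β, MonadicPredicate.IsRegular fun n => {i | f n i ∈ S} := by
  obtain ⟨σ, _, M, rfl⟩ := hL
  have : Inhabited β := ⟨w 1 0⟩
  set N := Fintype.card σ with hN
  have hNpos : 0 < N := Fintype.card_pos_iff.2 ⟨M.start⟩
  -- A pumped factor has length between 1 and `N`, so it divides `q`: one modulus serves all
  -- residues.
  set q := N.factorial with hq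
  have hqpos : 0 < q := N.factorial_pos
  have pump : ∀ r : ℕ, ∃ x y z : List β, y.length ∣ q ∧
      x.length + y.length + z.length = N * q + r + 1 ∧
      ∀ k, x ++ (List.replicate k y).flatten ++ z ∈ M.accepts := by
    intro r
    obtain ⟨x, y, z, he, hle, hy, hm⟩ := M.pumping_lemma (hw (N * q + r + 1)) (by
      rw [List.length_ofFn]
      have := Nat.le_mul_of_pos_right N hqpos
      omega)
    refine ⟨x, y, z, Nat.dvd_factorial (List.length_pos_iff.2 hy) (by omega), ?_, fun k => hm ?_⟩
    · simpa [add_assoc] using (congrArg List.length he).symm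
    · refine Language.mem_mul.2 ⟨_, Language.mem_mul.2 ⟨x, rfl, _, ?_, rfl⟩, z, rfl, rfl⟩
      exact Language.mem_kstar.2 ⟨_, rfl, fun v hv => (List.mem_replicate.1 hv).2⟩
  choose x y z hdvd hlen hacc using pump
  -- From length `C` on, `n` is at least the length of the pumped word for its residue. Also `C`
  -- exceeds the lengths of all `x r` and `z r` with `r < q`, so distances truncated at `C` tell
  -- which factor a position lies in.
  set C := N * q + q + 1 with hC
  refine ⟨fun n i => if h : n < C then w n i else
    pumpLetter (x ((n - 1) % q)) (y ((n - 1) % q)) (z ((n - 1) % q)) n i, fun n => ?_, fun S => ?_⟩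
  · by_cases h : n < C
    · simp only [h, dif_pos]
      exact hw n
    · simp only [h, dif_neg, not_false_eq_true]
      set r := (n - 1) % q with hr
      have hrq : r < q := Nat.mod_lt _ hqpos
      obtain ⟨d, hd⟩ := hdvd r
      have hdiv := Nat.div_add_mod (n - 1) q
      rw [← hr] at hdiv
      have hge : N ≤ (n - 1) / q := by
        rw [Nat.le_div_iff_mul_le hqpos]
        omega
      obtain ⟨t, ht⟩ := Nat.exists_eq_add_of_le hge
      -- Here n - 1 = q(N + t) + r and q = |y|d, so the base word needs `d * t` extra copies of `y`.
      have hn : n = (x r).length + (1 + d * t) * (y r).length + (z r).length := by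
        have h1 : d * t * (y r).length = q * t := by
          rw [hd]; ring
        have h2 : q * ((n - 1) / q) = N * q + q * t := by
          rw [ht]; ring
        have h3 := hlen r
        rw [add_mul, h1]
        omega
      have := hacc r (1 + d * t)
      rw [← ofFn_pumpLetter] at this
      rw [hn]
      exact this
  · refine MonadicPredicate.isRegular_of_threshold_mod C hqpos ?_
    intro n n' i i' h1 h2 h3 h4 hi
    have hin := i.2
    have hin' := i'.2
    simp only [Set.mem_ofPred_eq] at hi ⊢
    by_cases h : n < C
    -- Below `C` truncation loses nothing: the two distances determine both the length and the
    -- position.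
    · have hn : n = n' := by omega
      subst hn
      have : i = i' := Fin.ext (by omega)
      rwa [← this]
    · have h' : ¬ n' < C := by omega
      rw [dif_neg h] at hi
      rw [dif_neg h', ← h4]
      have hrq : (n - 1) % q < q := Nat.mod_lt _ hqpos
      have hl := hlen ((n - 1) % q)
      convert hi using 1
      simp only [pumpLetter]
      by_cases ha : (i : ℕ) < (x ((n - 1) % q)).length
      · rw [if_pos ha, if_pos (by omega), show (i' : ℕ) = i by omega]
      · rw [if_neg ha, if_neg (by omega)]
        by_cases hb : n - 1 - (i : ℕ) < (z ((n - 1) % q)).length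
        · rw [if_pos hb, if_pos (by omega), show n' - 1 - (i' : ℕ) = n - 1 - i by omega]
        · rw [if_neg hb, if_neg (by omega)]
          congr 1
          refine Nat.ModEq.add_right_cancel' (x ((n - 1) % q)).length ?_
          rw [Nat.sub_add_cancel (by omega), Nat.sub_add_cancel (by omega)]
          exact (Nat.ModEq.of_dvd (hdvd _) h3).symm

end Language

/-! ### The main theorem -/

theorem mainTheorem2 {A : Type*} [Finite A] (ℓ : ℕ) (φ : MSOSentence A ℓ)
    (P : Fin ℓ → MonadicPredicate) (hL : (MSOSentence.language φ P).IsRegular) :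
    ∃ Q : Fin ℓ → MonadicPredicate,
      (∀ i, (Q i).IsRegular) ∧ MSOSentence.language φ Q = MSOSentence.language φ P := by
  have sat_iff : ∀ (R : Fin ℓ → MonadicPredicate) (n : ℕ) (u : Fin n → A),
      List.ofFn u ∈ φ.language R ↔ MSOFormula.Sat u R φ Fin.elim0 Fin.elim0 := by
    intro R n u
    change MSOFormula.Sat (List.ofFn u).get R φ Fin.elim0 Fin.elim0 ↔ _
    have : ∀ (m : ℕ) (hm : n = m) (v : Fin m → A), (∀ i, v i = u (i.cast hm.symm)) →
        (MSOFormula.Sat v R φ Fin.elim0 Fin.elim0 ↔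
          MSOFormula.Sat u R φ Fin.elim0 Fin.elim0) := by
      rintro _ rfl v hv
      rw [show v = u from funext hv]
    exact this _ (List.length_ofFn).symm _ fun i => by rw [List.get_ofFn]
  obtain ⟨f, hf, hreg⟩ := (φ.isRegular_advice hL).exists_regular_choice
    (fun n i => {k | i ∈ P k n}) fun n => (φ.ofFn_mem_advice _ P n).2 (sat_iff P n)
  refine ⟨fun k n => {i | k ∈ f n i}, fun k => hreg {s | k ∈ s}, ?_⟩
  ext v
  rw [← List.ofFn_get v, sat_iff]
  exact ((φ.ofFn_mem_advice _ (fun k n => {i | k ∈ f n i}) _).1 (hf _) _).symm
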